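/- Let $n,N,L$ be natural numbers, $A\in\mathbb{C}^{n\times N}$ with columns $a_1,\dots,a_N$, and let $S\subset\{1,\dots,N\}$ have cardinality $k$. Let $A_S\in\mathbb{C}^{n\times k}$ be the submatrix of the columns of $A$ indexed by $S$; assume that these columns are linearly independent, and put $A_S^\dagger=(A_S^*A_S)^{-1}A_S^*$. Let $0<\alpha<1$ and suppose that $$\|A_S^\dagger a_\ell\|_2\le\alpha\qquad\text{for all }\ell\notin S.$$ Let $\Sigma=\operatorname{diag}(\sigma_j,\,j\in S)$ be a real diagonal matrix, deterministic or random (and then not necessarily independent of the matrix $\Phi$ below), with (almost surely) positive diagonal entries. Let $X$ be the random $N\times L$ matrix whose rows indexed by $S$ form the $k\times L$ matrix $X^S=\Sigma\Phi$ and whose other rows are zero. For a matrix $Z\in\mathbb{C}^{N\times L}$ with rows $Z^1,\dots,Z^N$ let $\|Z\|_{2,1}=\sum_{j=1}^N\|Z^j\|_2$. We say that $\ell_{2,1}$-minimization recovers $X$ if $X$ is the unique solution of $$\min_{Z\in\mathbb{C}^{N\times L}}\|Z\|_{2,1}\quad\text{subject to}\quad AZ=AX.$$ (a) Suppose that the entries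 of $\Phi\in\mathbb{R}^{k\times L}$ are independent standard normal variables, or that the rows of $\Phi\in\mathbb{R}^{k\times L}$ are independent and uniformly distributed on the unit sphere of $\mathbb{R}^L$. Then $\ell_{2,1}$-minimization recovers $X$ with probability at least $$1-N\exp\Bigl(-\tfrac{L}{2}\bigl(\alpha^{-2}-\log(\alpha^{-2})-1\bigr)\Bigr).$$ (b) Suppose that the real and imaginary parts of the entries of $\Phi\in\mathbb{C}^{k\times L}$ are independent standard normal variables, or that the rows of $\Phi\in\mathbb{C}^{k\times L}$ are independent and uniformly distributed on the unit sphere of $\mathbb{C}^L$. Then $\ell_{2,1}$-minimization recovers $X$ with probability at least $$1-N\exp\Bigl(-L\bigl(\alpha^{-2}-\log(\alpha^{-2})-1\bigr)\Bigr).$$ -/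

import Mathlib

open MeasureTheory ProbabilityTheory

noncomputable section

/-- The submatrix `A_S` of the columns of `A` indexed by `S`. -/
def colSubmatrix {n N : ℕ} (A : Matrix (Fin n) (Fin N) ℂ) (S : Finset (Fin N)) :
    Matrix (Fin n) S ℂ :=
  A.submatrix id (fun j => (j : Fin N))

/-- The pseudo-inverse `B^† = (B^* B)⁻¹ B^*` of a matrix `B` with linearly independent columns. -/
def pinv {m κ : Type*} [Fintype m] [Fintype κ] [DecidableEq κ] (B : Matrix m κ ℂ) :
    Matrix κ m ℂ :=
  (B.conjTranspose * B)⁻¹ * B.conjTranspose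

/-- The mixed norm `‖X‖_{2,1}`: the sum of the Euclidean norms of the rows of `X`. -/
def norm21 {N L : ℕ} (X : Matrix (Fin N) (Fin L) ℂ) : ℝ :=
  ∑ j, ‖WithLp.toLp 2 (X j)‖

/-- `X` is a solution of the program `min ‖X‖_{2,1}` subject to `A X = Y`. -/
def IsL21Solution {n N L : ℕ} (A : Matrix (Fin n) (Fin N) ℂ) (Y : Matrix (Fin n) (Fin L) ℂ)
    (X : Matrix (Fin N) (Fin L) ℂ) : Prop :=
  A * X = Y ∧ ∀ X' : Matrix (Fin N) (Fin L) ℂ, A * X' = Y → norm21 X ≤ norm21 X'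

/-- `ℓ_{2,1}`-minimization recovers `X` from `Y = A X`: the matrix `X` is the one and only
solution of the program with data `Y = A X`. -/
def L21Recovers {n N L : ℕ} (A : Matrix (Fin n) (Fin N) ℂ) (X : Matrix (Fin N) (Fin L) ℂ) :
    Prop :=
  ∀ X' : Matrix (Fin N) (Fin L) ℂ, IsL21Solution A (A * X) X' ↔ X' = X

/-- The `N × L` matrix whose rows indexed by `S` are those of `M`, all other rows being zero. -/
def extendRows {N L : ℕ} (S : Finset (Fin N)) (M : Matrix S (Fin L) ℂ) :
    Matrix (Fin N) (Fin L) ℂ :=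
  Matrix.of fun i l => if h : i ∈ S then M ⟨i, h⟩ l else 0

/-- The uniform probability distribution on the unit sphere of a finite-dimensional real inner
product space `E ≠ 0`, as a measure on `E`: normalized surface measure. -/
def uniformSphere (E : Type*) [NormedAddCommGroup E] [InnerProductSpace ℝ E]
    [FiniteDimensional ℝ E] [MeasurableSpace E] [BorelSpace E] : Measure E :=
  (((volume : Measure E).toSphere Set.univ)⁻¹ • (volume : Measure E).toSphere).map
    (fun x : Metric.sphere (0 : E) 1 => (x : E))

variable {Ω : Type*} [MeasurableSpace Ω]

/-- Real Gaussian model: the entries of `Φ` are independent standard normal variables. -/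
def IsRealGaussian {κ : Type*} {L : ℕ} (Φ : Ω → Matrix κ (Fin L) ℝ) (μ : Measure Ω) : Prop :=
  (∀ p : κ × Fin L, HasLaw (fun ω => Φ ω p.1 p.2) (gaussianReal 0 1) μ) ∧
    iIndepFun (fun (p : κ × Fin L) ω => Φ ω p.1 p.2) μ

/-- Real spherical model: the rows of `Φ` are independent and uniformly distributed on the unit
sphere of `ℝ^L`. -/
def IsRealSpherical {κ : Type*} {L : ℕ} (Φ : Ω → Matrix κ (Fin L) ℝ) (μ : Measure Ω) : Prop :=
  (∀ j : κ, HasLaw (fun ω => WithLp.toLp 2 (Φ ω j))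
      (uniformSphere (EuclideanSpace ℝ (Fin L))) μ) ∧
    iIndepFun (fun (j : κ) ω => (WithLp.toLp 2 (Φ ω j) : EuclideanSpace ℝ (Fin L))) μ

/-- Complex Gaussian model: the real and imaginary parts of all entries of `Φ` are independent
standard normal variables. -/
def IsComplexGaussian {κ : Type*} {L : ℕ} (Φ : Ω → Matrix κ (Fin L) ℂ) (μ : Measure Ω) : Prop :=
  (∀ p : κ × Fin L, HasLaw (fun ω => (Φ ω p.1 p.2).re) (gaussianReal 0 1) μ ∧
      HasLaw (fun ω => (Φ ω p.1 p.2).im) (gaussianReal 0 1) μ) ∧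
    iIndepFun (Sum.elim (fun (p : κ × Fin L) ω => (Φ ω p.1 p.2).re)
      (fun (p : κ × Fin L) ω => (Φ ω p.1 p.2).im)) μ

/-- Complex spherical model: the rows of `Φ` are independent and uniformly distributed on the unit
sphere of `ℂ^L` (the unit sphere of the underlying real Euclidean space of dimension `2 L`). -/
def IsComplexSpherical {κ : Type*} {L : ℕ} (Φ : Ω → Matrix κ (Fin L) ℂ) (μ : Measure Ω) : Prop :=
  (∀ j : κ, HasLaw (fun ω => WithLp.toLp 2 (Φ ω j))
      (uniformSphere (EuclideanSpace ℂ (Fin L))) μ) ∧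
    iIndepFun (fun (j : κ) ω => (WithLp.toLp 2 (Φ ω j) : EuclideanSpace ℂ (Fin L))) μ

end

section SubGaussian

open scoped ENNReal RealInnerProductSpace

/-! ### Convexity of `cosh ∘ √` -/

/-! Write `b ℓ` for the conjugate of `A_S^† a_ℓ` and `u j` for the direction of row `j` of `X`.
Since `u j` is a subgradient of the norm at that row, `X` is recovered as soon as `‖∑ j, b ℓ j • u
j‖ < 1` for every `ℓ ∉ S` (`l21Recovers_extendRows`). Positive scaling leaves directions unchanged,
so `Σ` disappears pointwise, whatever its dependence on `Φ`. In all four models the directions are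
independent rotation invariant vectors in the unit ball of a real space of dimension `d`, with `d =
L` or `d = 2L`.

Such a vector `z` satisfies `E exp⟪z, h⟫ ≤ exp(‖h‖² / 2d)`, as a Gaussian of covariance `I/d` does
(`IsRotationInvariant.lintegral_exp_inner_le`). By independence, `Y = ∑ b_j u_j` with `∑ |b_j|² ≤
α²` obeys the same bound with `α²‖h‖²`. Averaging over a Gaussian `h` turns this into `E exp(θ‖Y‖²)
≤ α^(-d)` for `θ = (d/2)(α⁻² - 1)` (`lintegral_exp_mul_norm_sum_sq_le`). Markov's inequality bounds
`P(‖Y‖ ≥ 1)` by `exp(-(d/2)(α⁻² - log α⁻² - 1))`, and a union bound over `ℓ` finishes. Real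
directions with complex coefficients need a further convexity argument
(`measure_one_le_norm_sum_sq_add_le`). -/

lemma hasSum_cosh_sqrt {s : ℝ} (hs : 0 ≤ s) :
    HasSum (fun n : ℕ => s ^ n / ((2 * n).factorial : ℝ)) (Real.cosh (√s)) := by
  have h := Real.hasSum_cosh (√s)
  simpa only [pow_mul, Real.sq_sqrt hs] using h

/-- The power series in `s` has nonnegative coefficients, and each `s ^ n` is convex on `[0, ∞)`. -/
lemma convexOn_cosh_sqrt : ConvexOn ℝ (Set.Ici 0) (fun s : ℝ => Real.cosh (√s)) := by
  refine ⟨convex_Ici 0, fun x hx y hy a b ha hb hab => ?_⟩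
  have hx' : (0 : ℝ) ≤ x := hx
  have hy' : (0 : ℝ) ≤ y := hy
  have hz : 0 ≤ a • x + b • y := by
    simp only [smul_eq_mul]; positivity
  refine hasSum_le (fun n => ?_) (hasSum_cosh_sqrt hz)
    (((hasSum_cosh_sqrt hx').const_smul a).add ((hasSum_cosh_sqrt hy').const_smul b))
  have h := (convexOn_pow (𝕜 := ℝ) n).2 hx hy ha hb hab
  simp only [smul_eq_mul] at h ⊢
  rw [← mul_div_assoc, ← mul_div_assoc, ← add_div]
  gcongr

/-! ### The standard Gaussian measure on a Euclidean space -/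

section Gaussian

variable {V : Type*} [NormedAddCommGroup V] [InnerProductSpace ℝ V] [FiniteDimensional ℝ V]
  [MeasurableSpace V] [BorelSpace V]

lemma map_inner_stdGaussian (w : V) :
    (stdGaussian V).map (fun g => ⟪w, g⟫) = gaussianReal 0 (‖w‖₊ ^ 2) := by
  have h := IsGaussian.map_eq_gaussianReal (μ := stdGaussian V) (innerSL ℝ w)
  rw [integral_strongDual_stdGaussian, variance_dual_stdGaussian, innerSL_apply_norm] at h
  rw [Real.toNNReal_pow (norm_nonneg _), norm_toNNReal] at h
  exact h

lemma lintegral_exp_inner_stdGaussian (w : V) :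
    ∫⁻ g, ENNReal.ofReal (Real.exp ⟪w, g⟫) ∂(stdGaussian V)
      = ENNReal.ofReal (Real.exp (‖w‖ ^ 2 / 2)) := by
  rw [← lintegral_map (f := fun x : ℝ => ENNReal.ofReal (Real.exp x)) (g := fun g => ⟪w, g⟫)
    (by fun_prop) (by fun_prop), map_inner_stdGaussian]
  have hi : Integrable (fun x => Real.exp x) (gaussianReal 0 (‖w‖₊ ^ 2)) := by
    simpa using integrable_exp_mul_gaussianReal (μ := 0) (v := ‖w‖₊ ^ 2) 1
  rw [← ofReal_integral_eq_lintegral_ofReal hi (.of_forall fun x => (Real.exp_pos x).le)]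
  have h := congrFun (mgf_id_gaussianReal (μ := 0) (v := ‖w‖₊ ^ 2)) 1
  simp only [mgf, id_eq, one_mul] at h
  rw [h]
  simp

lemma integrable_norm_sq_stdGaussian : Integrable (fun g : V => ‖g‖ ^ 2) (stdGaussian V) :=
  (IsGaussian.memLp_two_id (μ := stdGaussian V)).integrable_norm_pow two_ne_zero

lemma integral_norm_sq_stdGaussian :
    ∫ g : V, ‖g‖ ^ 2 ∂(stdGaussian V) = Module.finrank ℝ V := by
  have h1 (i) : Integrable (fun g : V => ⟪stdOrthonormalBasis ℝ V i, g⟫ ^ 2) (stdGaussian V) := by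
    refine Integrable.mono' integrable_norm_sq_stdGaussian (by fun_prop) (.of_forall fun g => ?_)
    have := abs_real_inner_le_norm (stdOrthonormalBasis ℝ V i) g
    rw [(stdOrthonormalBasis ℝ V).norm_eq_one, one_mul] at this
    rw [Real.norm_eq_abs, abs_pow]
    gcongr
  have h2 (i) : ∫ g : V, ⟪stdOrthonormalBasis ℝ V i, g⟫ ^ 2 ∂(stdGaussian V) = 1 := by
    have hv := variance_dual_stdGaussian (innerSL ℝ (stdOrthonormalBasis ℝ V i))
    rw [variance_of_integral_eq_zero (by fun_prop) (integral_strongDual_stdGaussian _),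
      innerSL_apply_norm, (stdOrthonormalBasis ℝ V).norm_eq_one] at hv
    simpa using hv
  simp_rw [← (stdOrthonormalBasis ℝ V).sum_sq_inner_right]
  rw [integral_finsetSum _ fun i _ => h1 i]
  simp [h2]

lemma integral_exp_mul_sq_gaussianReal {c : ℝ} (hc : c < 1 / 2) :
    ∫ x, Real.exp (c * x ^ 2) ∂(gaussianReal 0 1) = (1 - 2 * c) ^ (-(1 / 2) : ℝ) := by
  have h0 : 0 < 1 - 2 * c := by linarith
  have hpi := Real.pi_pos
  rw [integral_gaussianReal_eq_integral_smul one_ne_zero]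
  have h (x : ℝ) : gaussianPDFReal 0 1 x • Real.exp (c * x ^ 2)
      = (√(2 * Real.pi))⁻¹ * Real.exp (-((1 - 2 * c) / 2) * x ^ 2) := by
    rw [gaussianPDFReal, smul_eq_mul, mul_assoc, ← Real.exp_add]
    simp only [NNReal.coe_one, mul_one, sub_zero]
    congr 2
    ring
  simp_rw [h]
  rw [integral_const_mul, integral_gaussian, Real.rpow_neg h0.le, ← Real.sqrt_eq_rpow,
    ← Real.sqrt_inv, ← Real.sqrt_inv, ← Real.sqrt_mul (by positivity)]
  congr 1
  field_simp

lemma integrable_exp_mul_sq_gaussianReal {c : ℝ} (hc : c < 1 / 2) :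
    Integrable (fun x => Real.exp (c * x ^ 2)) (gaussianReal 0 1) := by
  refine Integrable.of_integral_ne_zero ?_
  rw [integral_exp_mul_sq_gaussianReal hc]
  have h0 : 0 < 1 - 2 * c := by linarith
  positivity

lemma lintegral_exp_mul_norm_sq_stdGaussian {c : ℝ} (hc : c < 1 / 2) :
    ∫⁻ g : V, ENNReal.ofReal (Real.exp (c * ‖g‖ ^ 2)) ∂(stdGaussian V)
      = ENNReal.ofReal ((1 - 2 * c) ^ (-(Module.finrank ℝ V / 2) : ℝ)) := by
  have h0 : 0 < 1 - 2 * c := by linarith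
  rw [stdGaussian, lintegral_map (by fun_prop) (by fun_prop)]
  have h (x : Fin (Module.finrank ℝ V) → ℝ) :
      Real.exp (c * ‖∑ i, x i • stdOrthonormalBasis ℝ V i‖ ^ 2)
        = ∏ i, Real.exp (c * x i ^ 2) := by
    rw [← Real.exp_sum, ← Finset.mul_sum, ← (stdOrthonormalBasis ℝ V).sum_sq_inner_right]
    simp only [(stdOrthonormalBasis ℝ V).orthonormal.inner_right_fintype]
  simp_rw [h]
  rw [← ofReal_integral_eq_lintegral_ofReal
      (Integrable.fintype_prod fun _ => integrable_exp_mul_sq_gaussianReal hc)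
      (.of_forall fun x => Finset.prod_nonneg fun i _ => (Real.exp_pos _).le),
    integral_fintype_prod_eq_prod (f := fun _ x => Real.exp (c * x ^ 2))]
  simp only [integral_exp_mul_sq_gaussianReal hc, Finset.prod_const, Finset.card_univ,
    Fintype.card_fin]
  rw [← Real.rpow_natCast, ← Real.rpow_mul h0.le]
  congr 2
  ring

/-- Jensen's inequality for the convex `cosh ∘ √` at the variable `‖g‖² y² / d`, whose mean is `y²`
because `E‖g‖² = d`. -/
lemma cosh_le_lintegral_cosh_stdGaussian (hd : 0 < Module.finrank ℝ V) (y : ℝ) :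
    ENNReal.ofReal (Real.cosh y)
      ≤ ∫⁻ g : V, ENNReal.ofReal (Real.cosh (‖g‖ / √(Module.finrank ℝ V) * y))
          ∂(stdGaussian V) := by
  set d : ℝ := ((Module.finrank ℝ V : ℕ) : ℝ) with hd_def
  have hd0 : 0 < d := by rw [hd_def]; exact_mod_cast hd
  have hsq (g : V) : Real.cosh (√(‖g‖ ^ 2 * (y ^ 2 / d))) = Real.cosh (‖g‖ / √d * y) := by
    rw [show ‖g‖ ^ 2 * (y ^ 2 / d) = (‖g‖ / √d * y) ^ 2 by
      rw [mul_pow, div_pow, Real.sq_sqrt hd0.le]; ring, Real.sqrt_sq_eq_abs, Real.cosh_abs]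
  by_cases hi : Integrable (fun g : V => Real.cosh (‖g‖ / √d * y)) (stdGaussian V)
  · rw [← ofReal_integral_eq_lintegral_ofReal hi (.of_forall fun x => (Real.cosh_pos _).le)]
    refine ENNReal.ofReal_le_ofReal ?_
    have h := convexOn_cosh_sqrt.map_integral_le (μ := stdGaussian V)
      (f := fun g => ‖g‖ ^ 2 * (y ^ 2 / d))
      (Real.continuous_cosh.comp Real.continuous_sqrt).continuousOn isClosed_Ici
      (.of_forall fun g => by simp only [Set.mem_Ici]; positivity)
      (integrable_norm_sq_stdGaussian.mul_const _)
      (by simpa only [Function.comp_def, hsq] using hi)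
    simp only [hsq] at h
    rw [integral_mul_const, integral_norm_sq_stdGaussian, ← hd_def, mul_div_cancel₀ _ hd0.ne',
      Real.sqrt_sq_eq_abs, Real.cosh_abs] at h
    exact h
  · have : ∫⁻ g : V, ENNReal.ofReal (Real.cosh (‖g‖ / √d * y)) ∂(stdGaussian V) = ∞ := by
      by_contra hne
      refine hi ((lintegral_ofReal_ne_top_iff_integrable ?_
        (.of_forall fun x => (Real.cosh_pos _).le)).1 hne)
      exact (Real.continuous_cosh.comp (by fun_prop)).aestronglyMeasurable
    rw [this]
    exact le_top

/-! ### Rotation invariant measures on the unit ball are sub-Gaussian -/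

/-- A measure on a Euclidean space that is invariant under all linear isometries. -/
def IsRotationInvariant (ν : Measure V) : Prop :=
  ∀ e : V ≃ₗᵢ[ℝ] V, ν.map e = ν

/-- The reflection in the hyperplane orthogonal to `v - w` carries `v` to `w`. -/
lemma IsRotationInvariant.lintegral_exp_inner_congr {ν : Measure V} (hν : IsRotationInvariant ν)
    {v w : V} (h : ‖v‖ = ‖w‖) :
    ∫⁻ z, ENNReal.ofReal (Real.exp ⟪z, v⟫) ∂ν = ∫⁻ z, ENNReal.ofReal (Real.exp ⟪z, w⟫) ∂ν := by
  obtain ⟨e, he⟩ : ∃ e : V ≃ₗᵢ[ℝ] V, e v = w := ⟨_, Submodule.reflection_sub h⟩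
  conv_rhs => rw [← hν e, lintegral_map (by fun_prop) e.continuous.measurable, ← he]
  simp only [LinearIsometryEquiv.inner_map_map]

lemma IsRotationInvariant.lintegral_cosh_inner {ν : Measure V} (hν : IsRotationInvariant ν)
    (v : V) :
    ∫⁻ z, ENNReal.ofReal (Real.cosh ⟪z, v⟫) ∂ν = ∫⁻ z, ENNReal.ofReal (Real.exp ⟪z, v⟫) ∂ν := by
  have h1 (z : V) : ENNReal.ofReal (Real.cosh ⟪z, v⟫)
      = 2⁻¹ * (ENNReal.ofReal (Real.exp ⟪z, v⟫) + ENNReal.ofReal (Real.exp ⟪z, -v⟫)) := by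
    rw [← ENNReal.ofReal_add (Real.exp_pos _).le (Real.exp_pos _).le, inner_neg_right,
      show (2⁻¹ : ℝ≥0∞) = ENNReal.ofReal 2⁻¹ by
        rw [ENNReal.ofReal_inv_of_pos two_pos]; simp, ← ENNReal.ofReal_mul (by norm_num),
      Real.cosh_eq]
    congr 1; ring
  simp_rw [h1]
  rw [lintegral_const_mul _ (by fun_prop), lintegral_add_left (by fun_prop),
    hν.lintegral_exp_inner_congr (norm_neg v), ← two_mul, ← mul_assoc,
    ENNReal.inv_mul_cancel two_ne_zero ENNReal.ofNat_ne_top, one_mul]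

/-- Symmetry replaces `exp` by `cosh`, and Jensen inserts a random factor `‖g‖ / √d`. Rotation
invariance then trades `‖g‖ • h` for `‖h‖ • g`, so that the integral over `g` becomes an explicit
Gaussian one, controlled by `‖z‖ ≤ 1`. -/
lemma IsRotationInvariant.lintegral_exp_inner_le {ν : Measure V} [IsProbabilityMeasure ν]
    (hν : IsRotationInvariant ν) (hball : ∀ᵐ z ∂ν, ‖z‖ ≤ 1) (h : V) :
    ∫⁻ z, ENNReal.ofReal (Real.exp ⟪z, h⟫) ∂ν
      ≤ ENNReal.ofReal (Real.exp (‖h‖ ^ 2 / (2 * Module.finrank ℝ V))) := by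
  -- In dimension zero the right side is `exp 0`, division by zero being zero.
  rcases Nat.eq_zero_or_pos (Module.finrank ℝ V) with hd | hd
  · have : Subsingleton V := Module.finrank_zero_iff.1 hd
    simp [Subsingleton.elim h 0]
  set d : ℝ := ((Module.finrank ℝ V : ℕ) : ℝ) with hd_def
  have hd0 : 0 < d := by rw [hd_def]; exact_mod_cast hd
  calc ∫⁻ z, ENNReal.ofReal (Real.exp ⟪z, h⟫) ∂ν
      = ∫⁻ z, ENNReal.ofReal (Real.cosh ⟪z, h⟫) ∂ν := (hν.lintegral_cosh_inner h).symm
    _ ≤ ∫⁻ z, ∫⁻ g : V, ENNReal.ofReal (Real.cosh (‖g‖ / √d * ⟪z, h⟫)) ∂(stdGaussian V) ∂ν :=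
        lintegral_mono fun z => cosh_le_lintegral_cosh_stdGaussian hd _
    _ = ∫⁻ g : V, ∫⁻ z, ENNReal.ofReal (Real.cosh ⟪z, (‖g‖ / √d) • h⟫) ∂ν ∂(stdGaussian V) := by
        rw [lintegral_lintegral_swap]
        · simp only [real_inner_smul_right]
        · have : Measurable Real.cosh := Real.continuous_cosh.measurable
          exact Measurable.aemeasurable (by unfold Function.uncurry; fun_prop)
    _ = ∫⁻ g : V, ∫⁻ z, ENNReal.ofReal (Real.exp ⟪z, (‖h‖ / √d) • g⟫) ∂ν ∂(stdGaussian V) := by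
        refine lintegral_congr fun g => ?_
        rw [hν.lintegral_cosh_inner]
        -- Both vectors have norm `‖g‖ ‖h‖ / √d`.
        refine hν.lintegral_exp_inner_congr ?_
        rw [norm_smul, norm_smul, Real.norm_of_nonneg (by positivity),
          Real.norm_of_nonneg (by positivity)]
        ring
    _ = ∫⁻ z, ∫⁻ g : V, ENNReal.ofReal (Real.exp ⟪(‖h‖ / √d) • z, g⟫) ∂(stdGaussian V) ∂ν := by
        rw [lintegral_lintegral_swap]
        · simp only [real_inner_smul_right, real_inner_smul_left]
        · exact Measurable.aemeasurable (by unfold Function.uncurry; fun_prop)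
    _ ≤ ∫⁻ _ : V, ENNReal.ofReal (Real.exp (‖h‖ ^ 2 / (2 * d))) ∂ν := by
        refine lintegral_mono_ae ?_
        filter_upwards [hball] with z hz
        rw [lintegral_exp_inner_stdGaussian]
        refine ENNReal.ofReal_le_ofReal (Real.exp_le_exp.2 ?_)
        rw [norm_smul, Real.norm_of_nonneg (by positivity), mul_pow, div_pow,
          Real.sq_sqrt hd0.le]
        have : ‖z‖ ^ 2 ≤ 1 := pow_le_one₀ (norm_nonneg z) hz
        calc ‖h‖ ^ 2 / d * ‖z‖ ^ 2 / 2 ≤ ‖h‖ ^ 2 / d * 1 / 2 := by gcongr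
          _ = ‖h‖ ^ 2 / (2 * d) := by field_simp
    _ = ENNReal.ofReal (Real.exp (‖h‖ ^ 2 / (2 * d))) := by simp

end Gaussian

/-! ### Tail bounds for sums of independent sub-Gaussian vectors -/

section Tail

variable {Ω : Type*} [MeasurableSpace Ω] {μ : Measure Ω}

/-- Markov's inequality for `exp (θ f)`. The value `θ = (d/2)(α⁻² - 1)` minimizes `exp(-θ) (1 -
2θα²/d)^(-d/2)`, and there the second factor is `α^(-d)`. -/
lemma measure_one_le_of_lintegral_exp_le {d α : ℝ} (hd : 0 ≤ d) (hα0 : 0 < α) (hα1 : α < 1)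
    {f : Ω → ℝ} (hf : AEMeasurable f μ)
    (h : ∫⁻ ω, ENNReal.ofReal (Real.exp (d / 2 * ((α ^ 2)⁻¹ - 1) * f ω)) ∂μ
      ≤ ENNReal.ofReal ((α ^ 2) ^ (-(d / 2)))) :
    μ {ω | 1 ≤ f ω}
      ≤ ENNReal.ofReal (Real.exp (-(d / 2) * ((α ^ 2)⁻¹ - Real.log ((α ^ 2)⁻¹) - 1))) := by
  set θ := d / 2 * ((α ^ 2)⁻¹ - 1) with hθ
  have hα2 : 0 < α ^ 2 := by positivity
  have hθ0 : 0 ≤ θ := mul_nonneg (by linarith)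
    (sub_nonneg.2 ((one_le_inv₀ hα2).2 (pow_le_one₀ hα0.le hα1.le)))
  have hm := mul_meas_ge_le_lintegral₀ (μ := μ)
    (f := fun ω => ENNReal.ofReal (Real.exp (θ * f ω))) (by fun_prop)
    (ENNReal.ofReal (Real.exp θ))
  have hsub : {ω | 1 ≤ f ω}
      ⊆ {ω | ENNReal.ofReal (Real.exp θ) ≤ ENNReal.ofReal (Real.exp (θ * f ω))} := fun ω hω =>
    ENNReal.ofReal_le_ofReal (Real.exp_le_exp.2 (le_mul_of_one_le_right hθ0 hω))
  have hexp : (1 : ℝ≥0∞) = ENNReal.ofReal (Real.exp (-θ)) * ENNReal.ofReal (Real.exp θ) := by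
    rw [← ENNReal.ofReal_mul (Real.exp_pos _).le, ← Real.exp_add]; simp
  calc μ {ω | 1 ≤ f ω}
      = ENNReal.ofReal (Real.exp (-θ))
          * (ENNReal.ofReal (Real.exp θ) * μ {ω | 1 ≤ f ω}) := by
        rw [← mul_assoc, ← hexp, one_mul]
    _ ≤ ENNReal.ofReal (Real.exp (-θ)) * ENNReal.ofReal ((α ^ 2) ^ (-(d / 2))) := by
        gcongr
        exact ((by gcongr : _ ≤ _).trans hm).trans h
    _ = _ := by
        rw [← ENNReal.ofReal_mul (Real.exp_pos _).le, Real.rpow_def_of_pos hα2, ← Real.exp_add,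
          Real.log_inv]
        congr 2
        rw [hθ]; ring

variable {V : Type*} [NormedAddCommGroup V] [InnerProductSpace ℝ V] [FiniteDimensional ℝ V]
  [MeasurableSpace V] [BorelSpace V] {κ : Type*} [Fintype κ]

lemma lintegral_exp_inner_sum_le [IsProbabilityMeasure μ] {W : κ → Ω → V}
    (hW : ∀ j, AEMeasurable (W j) μ) (hind : iIndepFun W μ) {K : κ → ℝ} (h : V)
    (hK : ∀ j, ∫⁻ ω, ENNReal.ofReal (Real.exp ⟪W j ω, h⟫) ∂μ
      ≤ ENNReal.ofReal (Real.exp (K j))) :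
    ∫⁻ ω, ENNReal.ofReal (Real.exp ⟪∑ j, W j ω, h⟫) ∂μ
      ≤ ENNReal.ofReal (Real.exp (∑ j, K j)) := by
  have hφ : Measurable fun v : V => ENNReal.ofReal (Real.exp ⟪v, h⟫) := by fun_prop
  have hind' : iIndepFun (fun j => (hW j).mk (W j)) μ :=
    hind.congr fun j => (hW j).ae_eq_mk
  have hprod (ω : Ω) : ENNReal.ofReal (Real.exp ⟪∑ j, W j ω, h⟫)
      = ∏ j, ENNReal.ofReal (Real.exp ⟪W j ω, h⟫) := by
    rw [sum_inner, Real.exp_sum, ENNReal.ofReal_prod_of_nonneg fun _ _ => (Real.exp_pos _).le]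
  calc ∫⁻ ω, ENNReal.ofReal (Real.exp ⟪∑ j, W j ω, h⟫) ∂μ
      = ∫⁻ ω, ∏ j, ENNReal.ofReal (Real.exp ⟪(hW j).mk (W j) ω, h⟫) ∂μ := by
        refine lintegral_congr_ae ?_
        filter_upwards [ae_all_iff.2 fun j => (hW j).ae_eq_mk] with ω hω
        rw [hprod]
        simp only [hω]
    _ = ∏ j, ∫⁻ ω, ENNReal.ofReal (Real.exp ⟪(hW j).mk (W j) ω, h⟫) ∂μ :=
        lintegral_prod_eq_prod_lintegral_of_indepFun _ _
          (hind'.comp (fun _ v => ENNReal.ofReal (Real.exp ⟪v, h⟫)) fun _ => hφ)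
          fun j => hφ.comp (hW j).measurable_mk
    _ = ∏ j, ∫⁻ ω, ENNReal.ofReal (Real.exp ⟪W j ω, h⟫) ∂μ := by
        refine Finset.prod_congr rfl fun j _ => lintegral_congr_ae ?_
        filter_upwards [(hW j).ae_eq_mk] with ω hω
        rw [hω]
    _ ≤ ∏ j, ENNReal.ofReal (Real.exp (K j)) := Finset.prod_le_prod' fun j _ => hK j
    _ = ENNReal.ofReal (Real.exp (∑ j, K j)) := by
        rw [Real.exp_sum, ENNReal.ofReal_prod_of_nonneg fun _ _ => (Real.exp_pos _).le]

/-- The square is linearized: `exp(θ‖Y‖²)` is the Gaussian average of `exp⟪√(2θ) Y, g⟫`. After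
Fubini the sub-Gaussian bound applies for each fixed `g`, leaving an integral of `exp((1 - α²)/2 ·
‖g‖²)`, which is finite as `α > 0`. -/
lemma lintegral_exp_mul_norm_sum_sq_le [IsProbabilityMeasure μ] {W : κ → Ω → V}
    (hW : ∀ j, AEMeasurable (W j) μ) (hind : iIndepFun W μ) {t : κ → ℝ} {α : ℝ}
    (hα0 : 0 < α) (hα1 : α < 1) (ht : ∑ j, t j ^ 2 ≤ α ^ 2)
    (hmgf : ∀ j h, ∫⁻ ω, ENNReal.ofReal (Real.exp ⟪W j ω, h⟫) ∂μ
      ≤ ENNReal.ofReal (Real.exp (t j ^ 2 * (‖h‖ ^ 2 / (2 * Module.finrank ℝ V))))) :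
    ∫⁻ ω, ENNReal.ofReal (Real.exp
        ((Module.finrank ℝ V : ℝ) / 2 * ((α ^ 2)⁻¹ - 1) * ‖∑ j, W j ω‖ ^ 2)) ∂μ
      ≤ ENNReal.ofReal ((α ^ 2) ^ (-((Module.finrank ℝ V : ℝ) / 2))) := by
  set d : ℝ := ((Module.finrank ℝ V : ℕ) : ℝ) with hd_def
  have hd0 : 0 ≤ d := by positivity
  set θ := d / 2 * ((α ^ 2)⁻¹ - 1) with hθ
  have hα2 : 0 < α ^ 2 := by positivity
  have hα2' : α ^ 2 ≤ 1 := pow_le_one₀ hα0.le hα1.le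
  have hθ0 : 0 ≤ θ := mul_nonneg (by linarith) (sub_nonneg.2 ((one_le_inv₀ hα2).2 hα2'))
  have hs : √(2 * θ) ^ 2 = 2 * θ := Real.sq_sqrt (by positivity)
  have hY : AEMeasurable (fun ω => ∑ j, W j ω) μ :=
    Finset.aemeasurable_fun_sum _ fun j _ => hW j
  have hbound (g : V) :
      ∑ j, t j ^ 2 * (‖√(2 * θ) • g‖ ^ 2 / (2 * d)) ≤ (1 - α ^ 2) / 2 * ‖g‖ ^ 2 := by
    rw [← Finset.sum_mul, norm_smul, mul_pow, Real.norm_eq_abs, sq_abs, hs]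
    calc (∑ j, t j ^ 2) * (2 * θ * ‖g‖ ^ 2 / (2 * d))
        ≤ α ^ 2 * (2 * θ * ‖g‖ ^ 2 / (2 * d)) := by gcongr
      _ ≤ (1 - α ^ 2) / 2 * ‖g‖ ^ 2 := by
        rcases hd0.eq_or_lt with h0 | h0
        · rw [← h0, mul_zero, div_zero, mul_zero]
          exact mul_nonneg (by linarith) (sq_nonneg _)
        · rw [hθ]
          apply le_of_eq
          field_simp
  calc ∫⁻ ω, ENNReal.ofReal (Real.exp (θ * ‖∑ j, W j ω‖ ^ 2)) ∂μ
      = ∫⁻ ω, ∫⁻ g : V, ENNReal.ofReal (Real.exp ⟪√(2 * θ) • ∑ j, W j ω, g⟫)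
          ∂(stdGaussian V) ∂μ := by
        refine lintegral_congr fun ω => ?_
        rw [lintegral_exp_inner_stdGaussian, norm_smul, mul_pow, Real.norm_eq_abs, sq_abs, hs]
        congr 2; ring
    _ = ∫⁻ g : V, ∫⁻ ω, ENNReal.ofReal (Real.exp ⟪∑ j, W j ω, √(2 * θ) • g⟫) ∂μ
          ∂(stdGaussian V) := by
        rw [lintegral_lintegral_swap]
        · simp only [real_inner_smul_left, real_inner_smul_right]
        · have h1 : AEMeasurable (fun p : Ω × V => ∑ j, W j p.1) (μ.prod (stdGaussian V)) :=
            hY.comp_fst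
          unfold Function.uncurry
          fun_prop
    _ ≤ ∫⁻ g : V, ENNReal.ofReal (Real.exp ((1 - α ^ 2) / 2 * ‖g‖ ^ 2)) ∂(stdGaussian V) := by
        refine lintegral_mono fun g => ?_
        refine (lintegral_exp_inner_sum_le hW hind _ fun j => hmgf j _).trans ?_
        exact ENNReal.ofReal_le_ofReal (Real.exp_le_exp.2 (hbound g))
    _ = ENNReal.ofReal ((α ^ 2) ^ (-(d / 2))) := by
        rw [lintegral_exp_mul_norm_sq_stdGaussian (by linarith)]
        congr 2
        ring

end Tail

/-! ### Normalized rotation invariant vectors -/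

/-- The direction `‖v‖⁻¹ • v` of a vector, with value `0` at `0`. -/
noncomputable def direction {V : Type*} [NormedAddCommGroup V] [NormedSpace ℝ V] (v : V) : V :=
  ‖v‖⁻¹ • v

lemma norm_direction_le {V : Type*} [NormedAddCommGroup V] [NormedSpace ℝ V] (v : V) :
    ‖direction v‖ ≤ 1 := by
  rw [direction, norm_smul, norm_inv, norm_norm]
  exact inv_mul_le_one

section Direction

variable {Ω : Type*} [MeasurableSpace Ω] {μ : Measure Ω} [IsProbabilityMeasure μ]
  {V : Type*} [NormedAddCommGroup V] [InnerProductSpace ℝ V] [FiniteDimensional ℝ V]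
  [MeasurableSpace V] [BorelSpace V]

@[fun_prop]
lemma measurable_direction : Measurable (direction : V → V) := by
  unfold direction; fun_prop

/-- Taking directions commutes with linear isometries. -/
lemma IsRotationInvariant.map_direction {ν : Measure V} (hν : IsRotationInvariant ν) :
    IsRotationInvariant (ν.map direction) := by
  intro e
  conv_rhs => rw [← hν e]
  rw [Measure.map_map e.continuous.measurable measurable_direction,
    Measure.map_map measurable_direction e.continuous.measurable]
  congr 1
  ext v
  simp [direction]

lemma lintegral_exp_inner_direction_le {R : Ω → V} (hR : AEMeasurable R μ)
    (hinv : IsRotationInvariant (μ.map R)) (h : V) :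
    ∫⁻ ω, ENNReal.ofReal (Real.exp ⟪direction (R ω), h⟫) ∂μ
      ≤ ENNReal.ofReal (Real.exp (‖h‖ ^ 2 / (2 * Module.finrank ℝ V))) := by
  have := Measure.isProbabilityMeasure_map hR
  have := Measure.isProbabilityMeasure_map (μ := μ.map R) measurable_direction.aemeasurable
  have hb : ∀ᵐ z ∂(μ.map R).map direction, ‖z‖ ≤ 1 :=
    (ae_map_iff (by fun_prop) (measurableSet_le (by fun_prop) (by fun_prop))).2
      (.of_forall norm_direction_le)
  have := hinv.map_direction.lintegral_exp_inner_le hb h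
  rwa [lintegral_map (by fun_prop) measurable_direction,
    lintegral_map' (by fun_prop) hR] at this

variable {κ : Type*} [Fintype κ]

lemma lintegral_exp_mul_norm_sum_smul_direction_sq_le {R : κ → Ω → V}
    (hR : ∀ j, AEMeasurable (R j) μ) (hind : iIndepFun R μ)
    (hinv : ∀ j, IsRotationInvariant (μ.map (R j))) {c : κ → ℝ} {α : ℝ}
    (hα0 : 0 < α) (hα1 : α < 1) (hc : ∑ j, c j ^ 2 ≤ α ^ 2) :
    ∫⁻ ω, ENNReal.ofReal (Real.exp ((Module.finrank ℝ V : ℝ) / 2 * ((α ^ 2)⁻¹ - 1)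
        * ‖∑ j, c j • direction (R j ω)‖ ^ 2)) ∂μ
      ≤ ENNReal.ofReal ((α ^ 2) ^ (-((Module.finrank ℝ V : ℝ) / 2))) := by
  refine lintegral_exp_mul_norm_sum_sq_le (W := fun j ω => c j • direction (R j ω))
    (fun j => (measurable_direction.comp_aemeasurable (hR j)).const_smul _)
    (hind.comp (fun j v => c j • direction v) fun j => by fun_prop) hα0 hα1 hc fun j h => ?_
  simp only [real_inner_smul_left, ← real_inner_smul_right]
  refine (lintegral_exp_inner_direction_le (hR j) (hinv j) _).trans_eq ?_
  rw [norm_smul, mul_pow, Real.norm_eq_abs, sq_abs, mul_div_assoc]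

/-- Tail bound for the norm of `∑ b_j u_j` with complex coefficients `b_j = β_j + i γ_j` and
independent random real directions `u_j`. -/
lemma measure_one_le_norm_sum_sq_add_le {R : κ → Ω → V}
    (hR : ∀ j, AEMeasurable (R j) μ) (hind : iIndepFun R μ)
    (hinv : ∀ j, IsRotationInvariant (μ.map (R j))) {β γ : κ → ℝ} {α : ℝ}
    (hα0 : 0 < α) (hα1 : α < 1) (hc : ∑ j, (β j ^ 2 + γ j ^ 2) ≤ α ^ 2) :
    μ {ω | 1 ≤ ‖∑ j, β j • direction (R j ω)‖ ^ 2 + ‖∑ j, γ j • direction (R j ω)‖ ^ 2}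
      ≤ ENNReal.ofReal (Real.exp (-((Module.finrank ℝ V : ℝ) / 2)
          * ((α ^ 2)⁻¹ - Real.log ((α ^ 2)⁻¹) - 1))) := by
  have hmeas (c : κ → ℝ) : AEMeasurable (fun ω => ∑ j, c j • direction (R j ω)) μ :=
    Finset.aemeasurable_fun_sum _ fun j _ =>
      (measurable_direction.comp_aemeasurable (hR j)).const_smul _
  refine measure_one_le_of_lintegral_exp_le (by positivity) hα0 hα1
    (((hmeas β).norm.pow_const 2).add ((hmeas γ).norm.pow_const 2)) ?_
  set θ := (Module.finrank ℝ V : ℝ) / 2 * ((α ^ 2)⁻¹ - 1) with hθ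
  set B := ∑ j, β j ^ 2 with hB
  set G := ∑ j, γ j ^ 2 with hG
  rw [Finset.sum_add_distrib, ← hB, ← hG] at hc
  have hB0 : 0 ≤ B := Finset.sum_nonneg fun j _ => sq_nonneg _
  have hG0 : 0 ≤ G := Finset.sum_nonneg fun j _ => sq_nonneg _
  -- If all coefficients vanish, the weights `B / (B + G)` and `G / (B + G)` used below no longer
  -- sum to one.
  rcases (add_nonneg hB0 hG0).eq_or_lt with h0 | h0
  · have hBz : B = 0 := by linarith
    have hGz : G = 0 := by linarith
    have hβ (j) : β j = 0 := by
      have := (Finset.sum_eq_zero_iff_of_nonneg fun j _ => sq_nonneg (β j)).1 hBz j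
        (Finset.mem_univ _)
      simpa using this
    have hγ (j) : γ j = 0 := by
      have := (Finset.sum_eq_zero_iff_of_nonneg fun j _ => sq_nonneg (γ j)).1 hGz j
        (Finset.mem_univ _)
      simpa using this
    have := lintegral_exp_mul_norm_sum_smul_direction_sq_le hR hind hinv (c := 0) hα0 hα1
      (by simpa using sq_nonneg α)
    simpa [hβ, hγ] using this
  -- Each of the two families is rescaled to the full budget `B + G ≤ α²`, so that the sum of
  -- squares becomes a convex combination of two quantities with the same exponential moment bound.
  have key (c : κ → ℝ) (C : ℝ) (hC : ∑ j, c j ^ 2 = C) (hC0 : 0 ≤ C) :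
      ∃ c' : κ → ℝ, ∑ j, c' j ^ 2 ≤ α ^ 2 ∧ ∀ ω, ‖∑ j, c j • direction (R j ω)‖ ^ 2
        = C / (B + G) * ‖∑ j, c' j • direction (R j ω)‖ ^ 2 := by
    rcases hC0.eq_or_lt with hz | hz
    · have hcz (j) : c j = 0 := by
        have := (Finset.sum_eq_zero_iff_of_nonneg fun j _ => sq_nonneg (c j)).1
          (hC.trans hz.symm) j (Finset.mem_univ _)
        simpa using this
      exact ⟨0, by simpa using sq_nonneg α, fun ω => by simp [hcz, ← hz]⟩
    · refine ⟨fun j => √((B + G) / C) * c j, ?_, fun ω => ?_⟩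
      · simp only [mul_pow, ← Finset.mul_sum, hC]
        rw [Real.sq_sqrt (by positivity), div_mul_cancel₀ _ hz.ne']
        exact hc
      · simp only [mul_smul, ← Finset.smul_sum]
        rw [norm_smul, mul_pow, Real.norm_eq_abs, sq_abs, Real.sq_sqrt (by positivity)]
        field_simp
  obtain ⟨β', hβ', hβe⟩ := key β B rfl hB0
  obtain ⟨γ', hγ', hγe⟩ := key γ G rfl hG0
  set p := B / (B + G) with hp
  set q := G / (B + G) with hq
  have hp0 : 0 ≤ p := by positivity
  have hq0 : 0 ≤ q := by positivity
  have hpq : p + q = 1 := by rw [hp, hq, ← add_div, div_self h0.ne']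
  have hpt (ω : Ω) :
      ENNReal.ofReal (Real.exp (θ * (‖∑ j, β j • direction (R j ω)‖ ^ 2
        + ‖∑ j, γ j • direction (R j ω)‖ ^ 2)))
      ≤ ENNReal.ofReal p
          * ENNReal.ofReal (Real.exp (θ * ‖∑ j, β' j • direction (R j ω)‖ ^ 2))
        + ENNReal.ofReal q
          * ENNReal.ofReal (Real.exp (θ * ‖∑ j, γ' j • direction (R j ω)‖ ^ 2)) := by
    rw [← ENNReal.ofReal_mul hp0, ← ENNReal.ofReal_mul hq0,
      ← ENNReal.ofReal_add (by positivity) (by positivity), hβe, hγe]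
    refine ENNReal.ofReal_le_ofReal ?_
    have := convexOn_exp.2 (Set.mem_univ (θ * ‖∑ j, β' j • direction (R j ω)‖ ^ 2))
      (Set.mem_univ (θ * ‖∑ j, γ' j • direction (R j ω)‖ ^ 2)) hp0 hq0 hpq
    simp only [smul_eq_mul] at this
    refine le_trans (le_of_eq ?_) this
    congr 1; ring
  have hm (c : κ → ℝ) : AEMeasurable
      (fun ω => ENNReal.ofReal (Real.exp (θ * ‖∑ j, c j • direction (R j ω)‖ ^ 2))) μ := by
    have := hmeas c
    fun_prop
  refine (lintegral_mono hpt).trans ?_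
  rw [lintegral_add_left' ((hm _).const_mul _), lintegral_const_mul'' _ (hm _),
    lintegral_const_mul'' _ (hm _)]
  calc _ ≤ ENNReal.ofReal p * ENNReal.ofReal ((α ^ 2) ^ (-((Module.finrank ℝ V : ℝ) / 2)))
        + ENNReal.ofReal q * ENNReal.ofReal ((α ^ 2) ^ (-((Module.finrank ℝ V : ℝ) / 2))) := by
        gcongr
        · exact lintegral_exp_mul_norm_sum_smul_direction_sq_le hR hind hinv hα0 hα1 hβ'
        · exact lintegral_exp_mul_norm_sum_smul_direction_sq_le hR hind hinv hα0 hα1 hγ'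
    _ = _ := by
        rw [← add_mul, ← ENNReal.ofReal_add hp0 hq0, hpq, ENNReal.ofReal_one, one_mul]

/-- Moving a complex coefficient onto `h` only scales `‖h‖` by its modulus, so complex coefficients
keep the sub-Gaussian bound in real dimension `2L`. -/
lemma real_inner_smul_left_euclideanSpace {ι : Type*} [Fintype ι] (b : ℂ)
    (z h : EuclideanSpace ℂ ι) : ⟪b • z, h⟫ = ⟪z, (starRingEnd ℂ b) • h⟫ := by
  simp only [PiLp.inner_apply, PiLp.smul_apply, smul_eq_mul, Complex.inner, map_mul]
  refine Finset.sum_congr rfl fun i _ => ?_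
  congr 1; ring

lemma finrank_real_euclideanSpace_complex (L : ℕ) :
    Module.finrank ℝ (EuclideanSpace ℂ (Fin L)) = 2 * L := by
  rw [← Module.finrank_mul_finrank ℝ ℂ (EuclideanSpace ℂ (Fin L)), Complex.finrank_real_complex,
    finrank_euclideanSpace_fin]

lemma measure_one_le_norm_sum_smul_direction_sq_le {L : ℕ}
    {R : κ → Ω → EuclideanSpace ℂ (Fin L)}
    (hR : ∀ j, AEMeasurable (R j) μ) (hind : iIndepFun R μ)
    (hinv : ∀ j, IsRotationInvariant (μ.map (R j))) {b : κ → ℂ} {α : ℝ}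
    (hα0 : 0 < α) (hα1 : α < 1) (hb : ∑ j, ‖b j‖ ^ 2 ≤ α ^ 2) :
    μ {ω | 1 ≤ ‖∑ j, b j • direction (R j ω)‖ ^ 2}
      ≤ ENNReal.ofReal (Real.exp (-(L : ℝ) * ((α ^ 2)⁻¹ - Real.log ((α ^ 2)⁻¹) - 1))) := by
  have hd : (Module.finrank ℝ (EuclideanSpace ℂ (Fin L)) : ℝ) / 2 = L := by
    rw [finrank_real_euclideanSpace_complex]; push_cast; ring
  have hm (j) : Measurable fun v : EuclideanSpace ℂ (Fin L) => b j • direction v :=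
    measurable_direction.const_smul (b j)
  rw [← hd]
  refine measure_one_le_of_lintegral_exp_le (by positivity) hα0 hα1
    ((Finset.aemeasurable_fun_sum _ fun j _ =>
      (hm j).comp_aemeasurable (hR j)).norm.pow_const 2) ?_
  refine lintegral_exp_mul_norm_sum_sq_le (W := fun j ω => b j • direction (R j ω))
    (fun j => (hm j).comp_aemeasurable (hR j))
    (hind.comp (fun j v => b j • direction v) hm) hα0 hα1 hb fun j h => ?_
  simp only [real_inner_smul_left_euclideanSpace]
  refine (lintegral_exp_inner_direction_le (hR j) (hinv j) _).trans_eq ?_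
  rw [norm_smul, mul_pow, RCLike.norm_conj, mul_div_assoc]

end Direction

end SubGaussian

/-! ### The dual certificate for `ℓ_{2,1}`-minimization -/

section Recovery

open scoped ComplexInnerProductSpace ComplexOrder

lemma re_inner_direction_self {V : Type*} [NormedAddCommGroup V] [InnerProductSpace ℂ V]
    [NormedSpace ℝ V] [IsScalarTower ℝ ℂ V] (v : V) : (⟪direction v, v⟫).re = ‖v‖ := by
  rw [direction, RCLike.real_smul_eq_coe_smul (K := ℂ), inner_smul_left,
    inner_self_eq_norm_sq_to_K]
  rcases eq_or_ne ‖v‖ 0 with h | h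
  · simp [h]
  · simp only [Complex.conj_ofReal, Complex.coe_algebraMap]
    norm_cast
    field_simp

/-- Cauchy–Schwarz for `direction v` against `v + h`. The case `v = 0` is covered, since only
`‖direction v‖ ≤ 1` is used. -/
lemma norm_add_re_inner_direction_le {V : Type*} [NormedAddCommGroup V] [InnerProductSpace ℂ V]
    [NormedSpace ℝ V] [IsScalarTower ℝ ℂ V] (v h : V) :
    ‖v‖ + (⟪direction v, h⟫).re ≤ ‖v + h‖ := by
  rw [← re_inner_direction_self v, ← Complex.add_re, ← inner_add_right]
  calc _ ≤ ‖direction v‖ * ‖v + h‖ := re_inner_le_norm (𝕜 := ℂ) _ _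
    _ ≤ _ := mul_le_of_le_one_left (norm_nonneg _) (norm_direction_le v)

lemma pinv_mul_self {m κ : Type*} [Fintype m] [Fintype κ] [DecidableEq κ] {B : Matrix m κ ℂ}
    (hB : LinearIndependent ℂ B.col) : pinv B * B = 1 := by
  rw [pinv, Matrix.mul_assoc]
  refine Matrix.nonsing_inv_mul _ ?_
  rw [← Matrix.isUnit_iff_isUnit_det]
  refine (Matrix.PosDef.conjTranspose_mul_self B ?_).isUnit
  exact Matrix.mulVec_injective_iff.2 hB

variable {n N L : ℕ} {A : Matrix (Fin n) (Fin N) ℂ} {S : Finset (Fin N)}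

/-- Multiply `A H = 0` by the pseudo-inverse, which acts as the identity on the columns in `S`. -/
lemma row_eq_neg_sum_of_mul_eq_zero (hA : LinearIndependent ℂ (colSubmatrix A S).col)
    {H : Matrix (Fin N) (Fin L) ℂ} (hH : A * H = 0) (j : S) :
    H j = -∑ ℓ ∈ Sᶜ, ((pinv (colSubmatrix A S)).mulVec (A.col ℓ)) j • H ℓ := by
  have hsplit (P : Matrix S (Fin n) ℂ) (l : Fin L) :
      ∑ ℓ, (P * A) j ℓ * H ℓ l = 0 := by
    have := congrFun (congrFun (show (P * A) * H = 0 by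
      rw [Matrix.mul_assoc, hH, Matrix.mul_zero]) j) l
    simpa [Matrix.mul_apply (M := P * A)] using this
  have hS (i : S) : (pinv (colSubmatrix A S) * A) j i = (1 : Matrix S S ℂ) j i := by
    rw [← pinv_mul_self hA]; rfl
  ext l
  have h := hsplit (pinv (colSubmatrix A S)) l
  rw [← Finset.sum_add_sum_compl S, ← Finset.sum_coe_sort S] at h
  simp only [hS, Matrix.one_apply, ite_mul, one_mul, zero_mul, Finset.sum_ite_eq,
    Finset.mem_univ, if_true] at h
  rw [eq_neg_of_add_eq_zero_left h]
  simp only [Pi.neg_apply, Finset.sum_apply, Pi.smul_apply, smul_eq_mul]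
  rfl

lemma extendRows_apply_mem (M : Matrix S (Fin L) ℂ) (j : S) : extendRows S M j = M j := by
  ext l; simp [extendRows]

lemma extendRows_apply_notMem (M : Matrix S (Fin L) ℂ) {i : Fin N} (hi : i ∉ S) :
    extendRows S M i = 0 := by
  ext l; simp [extendRows, hi]

/-- On `S` the norm drops by at most the pairing of `H` with the directions. The kernel relation
rewrites that pairing through the rows of `H` off `S`, where it is strictly smaller than the norm
gained. -/
lemma norm21_extendRows_lt (hA : LinearIndependent ℂ (colSubmatrix A S).col)
    (M : Matrix S (Fin L) ℂ)
    (hM : ∀ ℓ ∉ S, ‖∑ j : S, starRingEnd ℂ ((pinv (colSubmatrix A S)).mulVec (A.col ℓ) j) •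
      direction (WithLp.toLp 2 (M j) : EuclideanSpace ℂ (Fin L))‖ < 1)
    {H : Matrix (Fin N) (Fin L) ℂ} (hH : A * H = 0) (hH0 : H ≠ 0) :
    norm21 (extendRows S M) < norm21 (extendRows S M + H) := by
  set b : Fin N → S → ℂ := fun ℓ => (pinv (colSubmatrix A S)).mulVec (A.col ℓ) with hb
  set u : S → EuclideanSpace ℂ (Fin L) := fun j => direction (WithLp.toLp 2 (M j)) with hu
  set r : Fin N → EuclideanSpace ℂ (Fin L) := fun i => WithLp.toLp 2 (H i) with hr
  have hrow (j : S) : r j = -∑ ℓ ∈ Sᶜ, b ℓ j • r ℓ := by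
    simp only [hr]
    rw [row_eq_neg_sum_of_mul_eq_zero hA hH j, WithLp.toLp_neg, WithLp.toLp_sum]
    rfl
  -- Strictness needs a nonzero row off `S`; without one, `hrow` would force `H = 0`.
  obtain ⟨ℓ₀, hℓ₀S, hℓ₀⟩ : ∃ ℓ ∉ S, r ℓ ≠ 0 := by
    by_contra! hcon
    refine hH0 ?_
    have hall (i : Fin N) : r i = 0 := by
      by_cases hi : i ∈ S
      · rw [hrow ⟨i, hi⟩, Finset.sum_eq_zero, neg_zero]
        intro ℓ hℓ
        rw [hcon ℓ (Finset.mem_compl.1 hℓ), smul_zero]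
      · exact hcon i hi
    ext i l
    exact congrArg (fun v : EuclideanSpace ℂ (Fin L) => v l) (hall i)
  have hsum : ∑ j : S, (⟪u j, r j⟫).re
      = -∑ ℓ ∈ Sᶜ, (⟪∑ j : S, starRingEnd ℂ (b ℓ j) • u j, r ℓ⟫).re := by
    simp only [hrow, inner_neg_right, inner_sum, inner_smul_right, sum_inner, inner_smul_left,
      Complex.conj_conj, Complex.neg_re, Complex.re_sum, Finset.sum_neg_distrib]
    rw [Finset.sum_comm]
  have hlt : ∑ ℓ ∈ Sᶜ, (⟪∑ j : S, starRingEnd ℂ (b ℓ j) • u j, r ℓ⟫).re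
      < ∑ ℓ ∈ Sᶜ, ‖r ℓ‖ := by
    have hle (ℓ : Fin N) : (⟪∑ j : S, starRingEnd ℂ (b ℓ j) • u j, r ℓ⟫).re
        ≤ ‖∑ j : S, starRingEnd ℂ (b ℓ j) • u j‖ * ‖r ℓ‖ := re_inner_le_norm (𝕜 := ℂ) _ _
    refine Finset.sum_lt_sum (fun ℓ hℓ => ?_) ⟨ℓ₀, Finset.mem_compl.2 hℓ₀S, ?_⟩
    · exact (hle ℓ).trans (mul_le_of_le_one_left (norm_nonneg _)
        (hM ℓ (Finset.mem_compl.1 hℓ)).le)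
    · exact (hle ℓ₀).trans_lt (mul_lt_of_lt_one_left (norm_pos_iff.2 hℓ₀) (hM ℓ₀ hℓ₀S))
  have h1 : norm21 (extendRows S M)
      = ∑ j : S, ‖(WithLp.toLp 2 (M j) : EuclideanSpace ℂ (Fin L))‖ := by
    rw [norm21, ← Finset.sum_add_sum_compl S, ← Finset.sum_coe_sort S,
      Finset.sum_eq_zero (s := Sᶜ), add_zero]
    · simp only [extendRows_apply_mem]
    · intro ℓ hℓ
      rw [extendRows_apply_notMem M (Finset.mem_compl.1 hℓ), WithLp.toLp_zero, norm_zero]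
  have h2 : norm21 (extendRows S M + H)
      = ∑ j : S, ‖(WithLp.toLp 2 (M j) : EuclideanSpace ℂ (Fin L)) + r j‖
        + ∑ ℓ ∈ Sᶜ, ‖r ℓ‖ := by
    rw [norm21, ← Finset.sum_add_sum_compl S, ← Finset.sum_coe_sort S]
    congr 1
    · refine Finset.sum_congr rfl fun j _ => ?_
      rw [← WithLp.toLp_add, ← extendRows_apply_mem M j]
      rfl
    · refine Finset.sum_congr rfl fun ℓ hℓ => ?_
      rw [← zero_add (r ℓ), ← WithLp.toLp_zero, ← extendRows_apply_notMem M (Finset.mem_compl.1 hℓ)]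
      rfl
  have h3 : ∑ j : S, (‖(WithLp.toLp 2 (M j) : EuclideanSpace ℂ (Fin L))‖ + (⟪u j, r j⟫).re)
      ≤ ∑ j : S, ‖(WithLp.toLp 2 (M j) : EuclideanSpace ℂ (Fin L)) + r j‖ :=
    Finset.sum_le_sum fun j _ => norm_add_re_inner_direction_le _ _
  rw [Finset.sum_add_distrib, hsum] at h3
  rw [h1, h2]
  linarith

/-- Tropp's sufficient condition: the dual certificate built from the directions of the rows
guarantees exact recovery. -/
lemma l21Recovers_extendRows (hA : LinearIndependent ℂ (colSubmatrix A S).col)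
    (M : Matrix S (Fin L) ℂ)
    (hM : ∀ ℓ ∉ S, ‖∑ j : S, starRingEnd ℂ ((pinv (colSubmatrix A S)).mulVec (A.col ℓ) j) •
      direction (WithLp.toLp 2 (M j) : EuclideanSpace ℂ (Fin L))‖ < 1) :
    L21Recovers A (extendRows S M) := by
  have key (Z : Matrix (Fin N) (Fin L) ℂ) (hZ : A * Z = A * extendRows S M)
      (hne : Z ≠ extendRows S M) : norm21 (extendRows S M) < norm21 Z := by
    have := norm21_extendRows_lt hA M hM (H := Z - extendRows S M)
      (by rw [Matrix.mul_sub, hZ, sub_self]) (sub_ne_zero.2 hne)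
    rwa [add_sub_cancel] at this
  intro Z
  constructor
  · intro hZ
    by_contra hne
    exact (key Z hZ.1 hne).not_ge (hZ.2 _ rfl)
  · rintro rfl
    refine ⟨rfl, fun Z hZ => ?_⟩
    by_cases hne : Z = extendRows S M
    · rw [hne]
    · exact (key Z hZ hne).le

end Recovery

/-! ### The random models -/

section Models

open scoped Pointwise

variable {V : Type*} [NormedAddCommGroup V] [InnerProductSpace ℝ V] [FiniteDimensional ℝ V]
  [MeasurableSpace V] [BorelSpace V]

lemma isRotationInvariant_stdGaussian : IsRotationInvariant (stdGaussian V) :=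
  fun e => stdGaussian_map e

/-- Surface measure of a set is, up to a constant, the volume of the cone over it. Cones commute
with linear isometries, which preserve volume. -/
lemma isRotationInvariant_uniformSphere : IsRotationInvariant (uniformSphere V) := by
  intro e
  have hval : Measurable (fun x : Metric.sphere (0 : V) 1 => (x : V)) := measurable_subtype_coe
  have hsets (s : Set V) (hs : MeasurableSet s) :
      (volume : Measure V).toSphere ((fun x : Metric.sphere (0 : V) 1 => (x : V)) ⁻¹' (e ⁻¹' s))
        = (volume : Measure V).toSphere
            ((fun x : Metric.sphere (0 : V) 1 => (x : V)) ⁻¹' s) := by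
    rw [Measure.toSphere_apply' _ (hval (e.continuous.measurable hs)),
      Measure.toSphere_apply' _ (hval hs)]
    congr 1
    have hpre : Set.Ioo (0 : ℝ) 1 • ((fun x : Metric.sphere (0 : V) 1 => (x : V)) ''
          ((fun x : Metric.sphere (0 : V) 1 => (x : V)) ⁻¹' (e ⁻¹' s)))
        = e ⁻¹' (Set.Ioo (0 : ℝ) 1 • ((fun x : Metric.sphere (0 : V) 1 => (x : V)) ''
          ((fun x : Metric.sphere (0 : V) 1 => (x : V)) ⁻¹' s))) := by
      ext v
      simp only [Set.mem_smul, Set.mem_image, Set.mem_preimage, Subtype.exists,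
        mem_sphere_zero_iff_norm, exists_and_left, exists_prop, exists_eq_right_right]
      constructor
      · rintro ⟨r, hr, w, ⟨hw, hw1⟩, rfl⟩
        exact ⟨r, hr, e w, ⟨hw, by rwa [e.norm_map]⟩, by simp⟩
      · rintro ⟨r, hr, w, ⟨hw, hw1⟩, hv⟩
        refine ⟨r, hr, e.symm w, ⟨by simpa using hw, by rwa [e.symm.norm_map]⟩, ?_⟩
        rw [← e.symm_apply_apply v, ← hv]
        simp
    rw [hpre, e.measurePreserving.measure_preimage_emb e.toHomeomorph.measurableEmbedding]
  ext s hs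
  rw [uniformSphere, Measure.map_apply e.continuous.measurable hs,
    Measure.map_apply hval (e.continuous.measurable hs), Measure.map_apply hval hs]
  simp only [Measure.smul_apply, hsets s hs]

variable {Ω : Type*} [MeasurableSpace Ω] {μ : Measure Ω} {κ : Type*}

/-- Independence means that the joint law is a product measure, and currying carries the product
over pairs to the product of the products over rows. -/
lemma iIndepFun_curry [Countable κ] {ι : Type*} [Countable ι] {𝓧 : Type*} [MeasurableSpace 𝓧]
    {X : κ × ι → Ω → 𝓧} (hX : ∀ p, AEMeasurable (X p) μ) (h : iIndepFun X μ) :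
    iIndepFun (fun j ω i => X (j, i) ω) μ := by
  have := h.isProbabilityMeasure
  have hp (p) : IsProbabilityMeasure (μ.map (X p)) := Measure.isProbabilityMeasure_map (hX p)
  have hrow (j : κ) : AEMeasurable (fun ω i => X (j, i) ω) μ :=
    aemeasurable_pi_lambda _ fun i => hX (j, i)
  have hrows (j : κ) : μ.map (fun ω i => X (j, i) ω)
      = Measure.infinitePi fun i => μ.map (X (j, i)) :=
    (h.precomp (g := fun i : ι => (j, i)) (Prod.mk_right_injective j)).map_fun_eq_infinitePi_map₀'
      fun i => hX (j, i)
  rw [iIndepFun_iff_map_fun_eq_infinitePi_map₀' hrow]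
  simp_rw [hrows]
  rw [← Measure.infinitePi_map_curry (fun j i => μ.map (X (j, i))),
    ← h.map_fun_eq_infinitePi_map₀' hX,
    AEMeasurable.map_map_of_aemeasurable (MeasurableEquiv.measurable _).aemeasurable
      (aemeasurable_pi_lambda _ hX)]
  rfl

/-- The rows `R j` are independent random vectors with rotation invariant distributions. -/
structure IsRotationInvariantFamily (R : κ → Ω → V) (μ : Measure Ω) : Prop where
  aemeasurable : ∀ j, AEMeasurable (R j) μ
  indep : iIndepFun R μ
  invariant : ∀ j, IsRotationInvariant (μ.map (R j))

lemma isRotationInvariantFamily_of_gaussian_coordinates [Countable κ] {ι : Type*} [Fintype ι]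
    (B : OrthonormalBasis ι ℝ V) {X : κ × ι → Ω → ℝ}
    (hX : ∀ p, HasLaw (X p) (gaussianReal 0 1) μ) (h : iIndepFun X μ) :
    IsRotationInvariantFamily (fun j ω => ∑ i, X (j, i) ω • B i) μ where
  aemeasurable j := Finset.aemeasurable_fun_sum _ fun i _ =>
    (hX (j, i)).aemeasurable.smul_const _
  indep := (iIndepFun_curry (fun p => (hX p).aemeasurable) h).comp
    (fun _ x => ∑ i, x i • B i) fun _ => by fun_prop
  invariant j := by
    have hlaw : μ.map (fun ω => ∑ i, X (j, i) ω • B i) = stdGaussian V := by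
      rw [stdGaussian_eq_map_pi_orthonormalBasis B]
      have := (h.precomp (g := fun i : ι => (j, i))
        (Prod.mk_right_injective j)).map_fun_eq_pi_map fun i => (hX (j, i)).aemeasurable
      simp_rw [fun i => (hX (j, i)).map_eq] at this
      rw [← this, AEMeasurable.map_map_of_aemeasurable
        (Measurable.aemeasurable (by fun_prop))
        (aemeasurable_pi_lambda _ fun i => (hX (j, i)).aemeasurable)]
      rfl
    rw [hlaw]
    exact isRotationInvariant_stdGaussian

variable {L : ℕ}

lemma IsRealGaussian.isRotationInvariantFamily [Countable κ]
    {Φ : Ω → Matrix κ (Fin L) ℝ} (h : IsRealGaussian Φ μ) :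
    IsRotationInvariantFamily
      (fun j ω => (WithLp.toLp 2 (Φ ω j) : EuclideanSpace ℝ (Fin L))) μ := by
  convert isRotationInvariantFamily_of_gaussian_coordinates (EuclideanSpace.basisFun (Fin L) ℝ)
    h.1 h.2 using 3 with j ω
  exact ((EuclideanSpace.basisFun (Fin L) ℝ).sum_repr _).symm

lemma IsRealSpherical.isRotationInvariantFamily
    {Φ : Ω → Matrix κ (Fin L) ℝ} (h : IsRealSpherical Φ μ) :
    IsRotationInvariantFamily
      (fun j ω => (WithLp.toLp 2 (Φ ω j) : EuclideanSpace ℝ (Fin L))) μ where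
  aemeasurable j := (h.1 j).aemeasurable
  indep := h.2
  invariant j := by rw [(h.1 j).map_eq]; exact isRotationInvariant_uniformSphere

lemma IsComplexSpherical.isRotationInvariantFamily
    {Φ : Ω → Matrix κ (Fin L) ℂ} (h : IsComplexSpherical Φ μ) :
    IsRotationInvariantFamily
      (fun j ω => (WithLp.toLp 2 (Φ ω j) : EuclideanSpace ℂ (Fin L))) μ where
  aemeasurable j := (h.1 j).aemeasurable
  indep := h.2
  invariant j := by rw [(h.1 j).map_eq]; exact isRotationInvariant_uniformSphere

lemma IsComplexGaussian.isRotationInvariantFamily [Countable κ]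
    {Φ : Ω → Matrix κ (Fin L) ℂ} (h : IsComplexGaussian Φ μ) :
    IsRotationInvariantFamily
      (fun j ω => (WithLp.toLp 2 (Φ ω j) : EuclideanSpace ℂ (Fin L))) μ := by
  set B : OrthonormalBasis ((_ : Fin L) × Fin 2) ℝ (EuclideanSpace ℂ (Fin L)) :=
    Pi.orthonormalBasis fun _ => Complex.orthonormalBasisOneI with hB
  -- The real coordinates of row `j` in the basis `1, i` of each factor `ℂ` are matched with the
  -- real and imaginary parts of its entries.
  let g : κ × ((_ : Fin L) × Fin 2) → (κ × Fin L) ⊕ (κ × Fin L) := fun p =>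
    if p.2.2 = 0 then Sum.inl (p.1, p.2.1) else Sum.inr (p.1, p.2.1)
  have hg : Function.Injective g := by
    rintro ⟨j, l, a⟩ ⟨j', l', a'⟩ hp
    fin_cases a <;> fin_cases a' <;> simp_all [g]
  have hlaw (p : κ × ((_ : Fin L) × Fin 2)) :
      HasLaw (Sum.elim (fun (p : κ × Fin L) ω => (Φ ω p.1 p.2).re)
        (fun (p : κ × Fin L) ω => (Φ ω p.1 p.2).im) (g p)) (gaussianReal 0 1) μ := by
    by_cases hp : p.2.2 = 0
    · simpa [g, hp] using (h.1 (p.1, p.2.1)).1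
    · simpa [g, hp] using (h.1 (p.1, p.2.1)).2
  convert isRotationInvariantFamily_of_gaussian_coordinates B hlaw (h.2.precomp hg)
    using 3 with j ω
  rw [← B.sum_repr (WithLp.toLp 2 (Φ ω j))]
  refine Finset.sum_congr rfl ?_
  rintro ⟨l, a⟩ -
  congr 1
  fin_cases a <;> simp [B, g, Pi.orthonormalBasis_repr]

end Models

/-! ### Recovery with high probability -/

section Main

lemma direction_smul_of_pos {V : Type*} [NormedAddCommGroup V] [NormedSpace ℝ V] {r : ℝ}
    (hr : 0 < r) (v : V) : direction (r • v) = direction v := by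
  rw [direction, direction, norm_smul, Real.norm_of_nonneg hr.le, smul_smul, mul_inv, mul_assoc,
    mul_comm, mul_assoc, mul_inv_cancel₀ hr.ne', mul_one]

/-- The embedding of `ℝ^ι` in `ℂ^ι`. -/
noncomputable def euclideanOfReal (ι : Type*) [Fintype ι] :
    EuclideanSpace ℝ ι →ₗᵢ[ℝ] EuclideanSpace ℂ ι where
  toFun v := WithLp.toLp 2 fun i => (v i : ℂ)
  map_add' v w := by ext; simp
  map_smul' r v := by ext; simp
  norm_map' v := by simp [EuclideanSpace.norm_eq]

/-- As the `v j` are real, the real and imaginary parts of the sum only involve those of the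
coefficients. -/
lemma norm_sum_smul_euclideanOfReal_sq {κ ι : Type*} [Fintype κ] [Fintype ι] (b : κ → ℂ)
    (v : κ → EuclideanSpace ℝ ι) :
    ‖∑ j, b j • euclideanOfReal ι (v j)‖ ^ 2
      = ‖∑ j, (b j).re • v j‖ ^ 2 + ‖∑ j, (b j).im • v j‖ ^ 2 := by
  rw [EuclideanSpace.norm_sq_eq, EuclideanSpace.norm_sq_eq, EuclideanSpace.norm_sq_eq,
    ← Finset.sum_add_distrib]
  refine Finset.sum_congr rfl fun i _ => ?_
  rw [Complex.sq_norm, Complex.normSq_apply]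
  simp [euclideanOfReal, sq]

lemma direction_euclideanOfReal {ι : Type*} [Fintype ι] (v : EuclideanSpace ℝ ι) :
    direction (euclideanOfReal ι v) = euclideanOfReal ι (direction v) := by
  rw [direction, direction, LinearIsometry.norm_map, map_smul]

variable {Ω : Type*} [MeasurableSpace Ω] {μ : Measure Ω} [IsProbabilityMeasure μ]

lemma one_sub_card_mul_le_measureReal {N : ℕ} {S : Finset (Fin N)} {G : Set Ω}
    {bad : Fin N → Set Ω} {ε : ℝ} (hε : 0 ≤ ε)
    (hbad : ∀ ℓ ∉ S, μ (bad ℓ) ≤ ENNReal.ofReal ε)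
    (hG : ∀ᵐ ω ∂μ, (∀ ℓ ∉ S, ω ∉ bad ℓ) → ω ∈ G) :
    1 - N * ε ≤ μ.real G := by
  have hsub : μ Gᶜ ≤ μ (⋃ ℓ ∈ Sᶜ, bad ℓ) := by
    refine measure_mono_ae ?_
    filter_upwards [hG] with ω hω hωG
    by_contra hcon
    refine hωG (hω fun ℓ hℓ hb => hcon ?_)
    exact Set.mem_biUnion (Finset.mem_coe.2 (Finset.mem_compl.2 hℓ)) hb
  have hle : μ Gᶜ ≤ ENNReal.ofReal (N * ε) := by
    calc μ Gᶜ ≤ ∑ ℓ ∈ Sᶜ, μ (bad ℓ) := hsub.trans (measure_biUnion_finset_le _ _)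
      _ ≤ ∑ ℓ ∈ Sᶜ, ENNReal.ofReal ε :=
        Finset.sum_le_sum fun ℓ hℓ => hbad ℓ (Finset.mem_compl.1 hℓ)
      _ ≤ ∑ _ℓ : Fin N, ENNReal.ofReal ε := Finset.sum_le_univ_sum_of_nonneg fun _ => zero_le
      _ = ENNReal.ofReal (N * ε) := by
        rw [Finset.sum_const, Finset.card_univ, Fintype.card_fin, nsmul_eq_mul,
          ENNReal.ofReal_mul (Nat.cast_nonneg N), ENNReal.ofReal_natCast]
  have hreal : μ.real Gᶜ ≤ N * ε := ENNReal.toReal_le_of_le_ofReal (by positivity) hle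
  -- Subadditivity suffices here, so `G` need not be measurable.
  have hone : 1 ≤ μ.real G + μ.real Gᶜ := by
    have := measureReal_union_le (μ := μ) G Gᶜ
    rwa [Set.union_compl_self, probReal_univ] at this
  linarith

end Main

theorem mainTheorem1 {Ω : Type*} [MeasurableSpace Ω] (μ : Measure Ω) [IsProbabilityMeasure μ]
    {n N L : ℕ} (A : Matrix (Fin n) (Fin N) ℂ) (S : Finset (Fin N))
    (hA : LinearIndependent ℂ (colSubmatrix A S).col)
    (α : ℝ) (hα0 : 0 < α) (hα1 : α < 1)
    (hα : ∀ ℓ : Fin N, ℓ ∉ S →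
      ‖WithLp.toLp 2 ((pinv (colSubmatrix A S)).mulVec (A.col ℓ))‖ ≤ α)
    (σ : Ω → S → ℝ) (hσm : ∀ j, AEMeasurable (fun ω => σ ω j) μ)
    (hσ : ∀ᵐ ω ∂μ, ∀ j, 0 < σ ω j) :
    (∀ Φ : Ω → Matrix S (Fin L) ℝ, IsRealGaussian Φ μ ∨ IsRealSpherical Φ μ →
      1 - (N : ℝ) * Real.exp (-((L : ℝ) / 2) * ((α ^ 2)⁻¹ - Real.log ((α ^ 2)⁻¹) - 1)) ≤
        μ.real {ω | L21Recovers A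
          (extendRows S ((Matrix.diagonal (σ ω) * Φ ω).map (fun x : ℝ => (x : ℂ))))}) ∧
    (∀ Φ : Ω → Matrix S (Fin L) ℂ, IsComplexGaussian Φ μ ∨ IsComplexSpherical Φ μ →
      1 - (N : ℝ) * Real.exp (-(L : ℝ) * ((α ^ 2)⁻¹ - Real.log ((α ^ 2)⁻¹) - 1)) ≤
        μ.real {ω | L21Recovers A
          (extendRows S (Matrix.diagonal (fun j => (σ ω j : ℂ)) * Φ ω))}) := by
  set b : Fin N → S → ℂ := fun ℓ j =>
    starRingEnd ℂ ((pinv (colSubmatrix A S)).mulVec (A.col ℓ) j) with hb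
  have hb2 (ℓ) (hℓ : ℓ ∉ S) : ∑ j, ‖b ℓ j‖ ^ 2 ≤ α ^ 2 := by
    have := pow_le_pow_left₀ (norm_nonneg _) (hα ℓ hℓ) 2
    rw [EuclideanSpace.norm_sq_eq] at this
    simpa [hb] using this
  refine ⟨fun Φ hΦ => ?_, fun Φ hΦ => ?_⟩
  · obtain ⟨hR, hind, hinv⟩ := hΦ.elim IsRealGaussian.isRotationInvariantFamily
      IsRealSpherical.isRotationInvariantFamily
    refine one_sub_card_mul_le_measureReal (S := S) (Real.exp_pos _).le
      (bad := fun ℓ => {ω | 1 ≤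
        ‖∑ j, (b ℓ j).re • direction (WithLp.toLp 2 (Φ ω j) : EuclideanSpace ℝ (Fin L))‖ ^ 2
        + ‖∑ j, (b ℓ j).im • direction (WithLp.toLp 2 (Φ ω j) : EuclideanSpace ℝ (Fin L))‖ ^ 2})
      (fun ℓ hℓ => ?_) ?_
    · have := measure_one_le_norm_sum_sq_add_le hR hind hinv (β := fun j => (b ℓ j).re)
        (γ := fun j => (b ℓ j).im) hα0 hα1
        (by simpa only [Complex.sq_norm, Complex.normSq_apply, ← sq] using hb2 ℓ hℓ)
      rwa [finrank_euclideanSpace_fin] at this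
    · filter_upwards [hσ] with ω hω hgood
      refine l21Recovers_extendRows hA _ fun ℓ hℓ => ?_
      -- The positive factor `σ ω j` cancels for each `ω` separately, so no independence from `Φ` is
      -- required.
      have hrow (j : S) : direction (WithLp.toLp 2
          ((Matrix.diagonal (σ ω) * Φ ω).map (fun x : ℝ => (x : ℂ)) j) :
            EuclideanSpace ℂ (Fin L))
          = euclideanOfReal (Fin L) (direction (WithLp.toLp 2 (Φ ω j))) := by
        rw [← direction_euclideanOfReal, ← direction_smul_of_pos (hω j)
          (euclideanOfReal (Fin L) (WithLp.toLp 2 (Φ ω j)))]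
        congr 1
        ext l
        simp [euclideanOfReal, Matrix.diagonal_mul]
      simp only [hrow]
      rw [← sq_lt_one_iff₀ (norm_nonneg _), norm_sum_smul_euclideanOfReal_sq]
      exact not_le.1 (hgood ℓ hℓ)
  · obtain ⟨hR, hind, hinv⟩ := hΦ.elim IsComplexGaussian.isRotationInvariantFamily
      IsComplexSpherical.isRotationInvariantFamily
    refine one_sub_card_mul_le_measureReal (S := S) (Real.exp_pos _).le
      (bad := fun ℓ => {ω | 1 ≤
        ‖∑ j, b ℓ j • direction (WithLp.toLp 2 (Φ ω j) : EuclideanSpace ℂ (Fin L))‖ ^ 2})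
      (fun ℓ hℓ => measure_one_le_norm_sum_smul_direction_sq_le hR hind hinv hα0 hα1
        (hb2 ℓ hℓ)) ?_
    filter_upwards [hσ] with ω hω hgood
    refine l21Recovers_extendRows hA _ fun ℓ hℓ => ?_
    have hrow (j : S) : direction (WithLp.toLp 2
        ((Matrix.diagonal (fun j => (σ ω j : ℂ)) * Φ ω) j) : EuclideanSpace ℂ (Fin L))
        = direction (WithLp.toLp 2 (Φ ω j)) := by
      rw [← direction_smul_of_pos (hω j) (WithLp.toLp 2 (Φ ω j))]
      congr 1
      ext l
      simp [Matrix.diagonal_mul]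
    simp only [hrow]
    rw [← sq_lt_one_iff₀ (norm_nonneg _)]
    exact not_le.1 (hgood ℓ hℓ)
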